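/- Let $I\subset\mathbb R$ be a bounded interval of positive length $|I|$. Write $\langle f\rangle_J=\frac1{|J|}\int_J f$, and call dyadic subintervals of $I$ the intervals obtained by cutting $I$ into $2^n$ consecutive intervals of equal length, $n=0,1,2,\dots$. For a real-valued $\varphi\in L^1(I)$ put $$\|\varphi\|_{\mathrm{BMO}^d(I)}=\sup_{J}\,\big\langle|\varphi-\langle\varphi\rangle_J|^2\big\rangle_J^{1/2}\in[0,\infty],$$ the supremum being over all dyadic subintervals $J$ of $I$, and for $\varepsilon\ge0$ let $\mathrm{BMO}^d_\varepsilon(I)=\{\varphi\in L^1(I):\|\varphi\|_{\mathrm{BMO}^d(I)}\le\varepsilon\}$. Let $\varepsilon_0^d=\sqrt2\,\log 2$ and, for $0\le\varepsilon<\varepsilon_0^d$, $$C^d(\varepsilon)=\frac{e^{-\varepsilon/\sqrt2}}{2-e^{\varepsilon/\sqrt2}}.$$ **Theorem.** (i) If $0\le\varepsilon<\varepsilon_0^d$, then for every $\varphi\in\mathrm{BMO}^d_\varepsilon(I)$ the function $e^\varphi$ is integrable on $I$ and $$\langle e^\varphi\rangle_I\le C^d(\varepsilon)\,e^{\langle\varphi\rangle_I}.$$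 (ii) The constant is sharp: if $0\le\varepsilon<\varepsilon_0^d$ and $C\in\mathbb R$ is such that $\langle e^\varphi\rangle_I\le C\,e^{\langle\varphi\rangle_I}$ for every $\varphi\in\mathrm{BMO}^d_\varepsilon(I)$, then $C\ge C^d(\varepsilon)$. (iii) The threshold is sharp: if $\varepsilon\ge\varepsilon_0^d$, then for every $C\in\mathbb R$ there is $\varphi\in\mathrm{BMO}^d_\varepsilon(I)$ with $e^\varphi$ integrable on $I$ and $\langle e^\varphi\rangle_I> C\,e^{\langle\varphi\rangle_I}$. -/

import Mathlib

open MeasureTheory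
open scoped ENNReal

/-- The `m`-th interval of the `n`-th generation of the dyadic lattice rooted in `I = (a, b]`
(`m = 0, …, 2 ^ n - 1`): `I` is cut into `2 ^ n` consecutive intervals of equal length. -/
def dyadicInterval (a b : ℝ) (n : ℕ) (m : Fin (2 ^ n)) : Set ℝ :=
  Set.Ioc (a + (b - a) * ((m : ℕ) : ℝ) / 2 ^ n) (a + (b - a) * (((m : ℕ) : ℝ) + 1) / 2 ^ n)

/-- The mean square oscillation `⟨|φ - ⟨φ⟩_J|²⟩_J` over a set `J`, with value in `[0, ∞]`
(it is `∞` if `φ` is integrable, but not square integrable, on `J`). -/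
noncomputable def meanSqOsc (φ : ℝ → ℝ) (J : Set ℝ) : ℝ≥0∞ :=
  ⨍⁻ x in J, ENNReal.ofReal ((φ x - ⨍ y in J, φ y) ^ 2) ∂volume

/-- The dyadic BMO norm of `φ` on `I = (a, b]`, based on `L²`: the square root of the supremum of
the mean square oscillations over all dyadic subintervals of `I`, with value in `[0, ∞]`. -/
noncomputable def dyadicBMONorm (a b : ℝ) (φ : ℝ → ℝ) : ℝ≥0∞ :=
  (⨆ (n : ℕ) (m : Fin (2 ^ n)), meanSqOsc φ (dyadicInterval a b n m)) ^ (1 / 2 : ℝ)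

/-- The closed ball of radius `ε` (for `0 ≤ ε`) centred at `0` in the dyadic BMO space on
`I = (a, b]`: all `φ ∈ L¹(I)` whose dyadic BMO norm is at most `ε`. -/
def dyadicBMOBall (a b ε : ℝ) : Set (ℝ → ℝ) :=
  {φ | IntegrableOn φ (Set.Ioc a b) ∧ dyadicBMONorm a b φ ≤ ENNReal.ofReal ε}

/-!
The proof is by the Bellman function method. Put `s = ε / √2`. A dyadic interval is recorded by the
mean `X` and the variance `V` of `φ` on it; the condition on the BMO norm says `0 ≤ V ≤ ε²` on every
dyadic subinterval. If `B` is a function of `(X, V)` whose value at an interval dominates the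
average of its values at the two halves, and `B(X, V) ≥ exp X`, then the average of
`exp ⟨φ⟩_J` over the intervals `J` of any generation is at most `B` at the whole interval. By the
Lebesgue differentiation theorem and Fatou's lemma the same bound holds for `exp φ`.

The function used here is `B(X, V) = exp X * ψ(√(δ² - V)) / ψ(δ)` with `ψ(w) = (1 - w) eʷ`, which is
locally concave on the strip `V ≤ δ²`. The parameter `δ ≥ ε` comes from
`exists_bellman_parameters`; it is fixed by the requirement that the dyadic inequality is an
equality for the jump from the top `V = ε²` to one half with `V = ε²` and one with `V = 0`, the
means differing by `2s`; this gives `B(X, ε²) = exp X * e⁻ˢ / (2 - eˢ)`. The segment that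
joins the points of the two halves may leave the strip, so the dyadic inequality `psi_midpoint` is
more than local concavity. In terms of `w = √(δ² - V)` it reads `eᵗ ψ(a) + e⁻ᵗ ψ(b) ≤ 2 ψ(w)` when
`a² + b² = 2 w² + 2 t²`. If `t ≤ w + a`, it is the sum of two tangent line inequalities for `ψ` as
a function of `w²`. If `t > w + a`, monotonicity in `w`, quasi-concavity in `t` and monotonicity
along the remaining edge reduce it to the extremal jump.

For the sharpness, the same extremal jump is iterated: the left half of the interval carries a
rescaled copy of the function raised by `s`, the right half the constant `-s`. This is the
logarithmic `staircase`. By self-similarity it has mean `0`, variance `2 s² = ε²` on every dyadic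
interval at the left end point (on the others it is constant), and exponential average
`e⁻ˢ / (2 - eˢ)`, which tends to infinity as `s` increases to `log 2`.
-/

open Filter Topology

/-! ### The profile of the Bellman function -/

/-- The profile `ψ(w) = (1 - w) eʷ` of the Bellman function. -/
noncomputable def psi (w : ℝ) : ℝ := (1 - w) * Real.exp w

lemma hasDerivAt_psi (w : ℝ) : HasDerivAt psi (-(w * Real.exp w)) w := by
  have h := ((hasDerivAt_const w (1 : ℝ)).sub (hasDerivAt_id w)).mul (Real.hasDerivAt_exp w)
  refine h.congr_deriv ?_
  simp only [Pi.sub_apply, id]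
  ring

lemma continuous_psi : Continuous psi := by unfold psi; fun_prop

lemma psi_zero : psi 0 = 1 := by simp [psi]

lemma antitoneOn_psi : AntitoneOn psi (Set.Ici 0) := by
  refine antitoneOn_of_deriv_nonpos (convex_Ici 0) continuous_psi.continuousOn
    (fun x _ => (hasDerivAt_psi x).differentiableAt.differentiableWithinAt) fun x hx => ?_
  rw [interior_Ici] at hx
  rw [(hasDerivAt_psi x).deriv]
  have := mul_pos hx (Real.exp_pos x)
  linarith

lemma monotoneOn_psi : MonotoneOn psi (Set.Iic 0) := by
  refine monotoneOn_of_deriv_nonneg (convex_Iic 0) continuous_psi.continuousOn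
    (fun x _ => (hasDerivAt_psi x).differentiableAt.differentiableWithinAt) fun x hx => ?_
  rw [interior_Iic] at hx
  rw [(hasDerivAt_psi x).deriv]
  have := mul_neg_of_neg_of_pos hx (Real.exp_pos x)
  linarith

lemma psi_pos {w : ℝ} (hw : w < 1) : 0 < psi w :=
  mul_pos (by linarith) (Real.exp_pos w)

lemma psi_le_psi_neg {k : ℝ} (hk : 0 ≤ k) : psi k ≤ psi (-k) := by
  have hd : ∀ x : ℝ, HasDerivAt (fun x => psi (-x) - psi x)
      (x * (Real.exp x - Real.exp (-x))) x := by
    intro x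
    have h1 : HasDerivAt (fun x : ℝ => psi (-x)) _ x :=
      (hasDerivAt_psi (-x)).comp x (hasDerivAt_neg x)
    refine (h1.sub (hasDerivAt_psi x)).congr_deriv ?_
    ring
  have hm : MonotoneOn (fun x => psi (-x) - psi x) (Set.Ici 0) := by
    refine monotoneOn_of_deriv_nonneg (convex_Ici 0)
      (fun x _ => (hd x).continuousAt.continuousWithinAt)
      (fun x _ => (hd x).differentiableAt.differentiableWithinAt) fun x hx => ?_
    rw [interior_Ici] at hx
    rw [(hd x).deriv]
    have hx' : (0 : ℝ) < x := hx
    have : Real.exp (-x) ≤ Real.exp x := Real.exp_le_exp.2 (by linarith)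
    exact mul_nonneg hx'.le (by linarith)
  have := hm (Set.mem_Ici.2 le_rfl) (Set.mem_Ici.2 hk) hk
  simp only [neg_zero, sub_self] at this
  linarith

/-- As a function of `w²`, the profile `ψ` is concave on `w ≥ 0`, with derivative `-eʷ / 2`; this
is the tangent line inequality. -/
lemma psi_le_tangent {a c : ℝ} (ha : 0 ≤ a) (hc : 0 ≤ c) :
    psi a ≤ psi c - Real.exp c / 2 * (a ^ 2 - c ^ 2) := by
  have hd : ∀ x : ℝ, HasDerivAt (fun x => psi x + Real.exp c / 2 * x ^ 2)
      (x * (Real.exp c - Real.exp x)) x := by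
    intro x
    have h1 := ((hasDerivAt_id x).pow 2).const_mul (Real.exp c / 2)
    refine ((hasDerivAt_psi x).add h1).congr_deriv ?_
    simp only [id]
    push_cast
    ring
  have key : psi a + Real.exp c / 2 * a ^ 2 ≤ psi c + Real.exp c / 2 * c ^ 2 := by
    rcases le_total a c with h | h
    · have hm : MonotoneOn (fun x => psi x + Real.exp c / 2 * x ^ 2) (Set.Icc 0 c) := by
        refine monotoneOn_of_deriv_nonneg (convex_Icc 0 c)
          (fun x _ => (hd x).continuousAt.continuousWithinAt)
          (fun x _ => (hd x).differentiableAt.differentiableWithinAt) fun x hx => ?_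
        rw [interior_Icc] at hx
        rw [(hd x).deriv]
        have := Real.exp_le_exp.2 hx.2.le
        exact mul_nonneg hx.1.le (by linarith)
      exact hm ⟨ha, h⟩ ⟨hc, le_rfl⟩ h
    · have hm : AntitoneOn (fun x => psi x + Real.exp c / 2 * x ^ 2) (Set.Ici c) := by
        refine antitoneOn_of_deriv_nonpos (convex_Ici c)
          (fun x _ => (hd x).continuousAt.continuousWithinAt)
          (fun x _ => (hd x).differentiableAt.differentiableWithinAt) fun x hx => ?_
        rw [interior_Ici] at hx
        rw [(hd x).deriv]
        have := Real.exp_le_exp.2 (le_of_lt hx)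
        have hx' : c < x := hx
        exact mul_nonpos_of_nonneg_of_nonpos (by linarith) (by linarith)
      exact hm (Set.mem_Ici.2 le_rfl) (Set.mem_Ici.2 h) h
  linarith

/-- The tangent line inequality also holds at a negative point `-k`, provided that `k ≤ a`. -/
lemma psi_le_tangent_neg {a k : ℝ} (hk : 0 ≤ k) (hka : k ≤ a) :
    psi a ≤ psi (-k) - Real.exp (-k) / 2 * (a ^ 2 - (-k) ^ 2) := by
  have h1 := psi_le_tangent (hk.trans hka) hk
  have h2 := psi_le_psi_neg hk
  have h3 : Real.exp (-k) ≤ Real.exp k := Real.exp_le_exp.2 (by linarith)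
  have h4 : 0 ≤ a ^ 2 - k ^ 2 := by nlinarith
  nlinarith

/-! ### The midpoint inequality -/

/-- The midpoint inequality for a jump `t` that is not too large: it is the sum of the tangent line
inequalities at `w - t` for `a` and at `w + t` for `b`. These two points and the midpoint lie on one
tangent to the upper boundary of the strip, along which the Bellman function is linear. -/
lemma psi_midpoint_of_le {a b w t : ℝ} (ha : 0 ≤ a) (hb : 0 ≤ b) (hw : 0 ≤ w) (ht : 0 ≤ t)
    (hwa : t ≤ w + a) (h : a ^ 2 + b ^ 2 = 2 * w ^ 2 + 2 * t ^ 2) :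
    Real.exp t * psi a + Real.exp (-t) * psi b ≤ 2 * psi w := by
  have hA : psi a ≤ psi (w - t) - Real.exp (w - t) / 2 * (a ^ 2 - (w - t) ^ 2) := by
    rcases le_total t w with h' | h'
    · exact psi_le_tangent ha (by linarith)
    · have := psi_le_tangent_neg (a := a) (k := t - w) (by linarith) (by linarith)
      rwa [neg_sub] at this
  have hB := psi_le_tangent (a := b) (c := w + t) hb (by linarith)
  have hA' := mul_le_mul_of_nonneg_left hA (Real.exp_pos t).le
  have hB' := mul_le_mul_of_nonneg_left hB (Real.exp_pos (-t)).le
  have e1 : Real.exp (w - t) = Real.exp w * Real.exp (-t) := by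
    rw [← Real.exp_add]; ring_nf
  have e2 : Real.exp (w + t) = Real.exp w * Real.exp t := Real.exp_add w t
  have e3 : Real.exp t * Real.exp (-t) = 1 := by rw [← Real.exp_add]; simp
  unfold psi at *
  rw [e1] at hA'
  rw [e2] at hB'
  have hA'' : Real.exp t * ((1 - a) * Real.exp a) ≤
      Real.exp w * ((1 - (w - t)) - (a ^ 2 - (w - t) ^ 2) / 2) := by
    refine hA'.trans (le_of_eq ?_)
    linear_combination (Real.exp w * ((1 - (w - t)) - (a ^ 2 - (w - t) ^ 2) / 2)) * e3
  have hB'' : Real.exp (-t) * ((1 - b) * Real.exp b) ≤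
      Real.exp w * ((1 - (w + t)) - (b ^ 2 - (w + t) ^ 2) / 2) := by
    refine hB'.trans (le_of_eq ?_)
    linear_combination (Real.exp w * ((1 - (w + t)) - (b ^ 2 - (w + t) ^ 2) / 2)) * e3
  refine (add_le_add hA'' hB'').trans (le_of_eq ?_)
  linear_combination (-(Real.exp w) / 2) * h

lemma hasDerivAt_psi_sqrt {u : ℝ} (hu : 0 < u) :
    HasDerivAt (fun u => psi √u) (-(Real.exp √u / 2)) u := by
  have h := (hasDerivAt_psi √u).comp u (Real.hasDerivAt_sqrt hu.ne')
  refine h.congr_deriv ?_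
  have := Real.sqrt_pos.2 hu
  field_simp

/-- For a large jump, the midpoint inequality gets worse as the parameter `w` at the midpoint
decreases. -/
lemma psi_midpoint_reduce_mid {a w t ω : ℝ} (hω : 0 ≤ ω) (hωw : ω ≤ w) (ha : 0 ≤ a)
    (hwa : w + a < t)
    (h : Real.exp t * psi a + Real.exp (-t) * psi √(2 * ω ^ 2 + 2 * t ^ 2 - a ^ 2) ≤ 2 * psi ω) :
    Real.exp t * psi a + Real.exp (-t) * psi √(2 * w ^ 2 + 2 * t ^ 2 - a ^ 2) ≤ 2 * psi w := by
  have hd : ∀ u : ℝ, 0 < u → HasDerivAt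
      (fun u => 2 * psi √u - Real.exp (-t) * psi √(2 * u + 2 * t ^ 2 - a ^ 2))
      (Real.exp (√(2 * u + 2 * t ^ 2 - a ^ 2) - t) - Real.exp √u) u := by
    intro u hu
    have hpos : 0 < 2 * u + 2 * t ^ 2 - a ^ 2 := by nlinarith
    have h1 : HasDerivAt (fun u : ℝ => 2 * u + 2 * t ^ 2 - a ^ 2) 2 u := by
      have := (((hasDerivAt_id u).const_mul 2).add_const (2 * t ^ 2)).sub_const (a ^ 2)
      simpa using this
    have h2 := (hasDerivAt_psi_sqrt hpos).comp u h1
    have h3 := ((hasDerivAt_psi_sqrt hu).const_mul 2).sub (h2.const_mul (Real.exp (-t)))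
    refine h3.congr_deriv ?_
    rw [sub_eq_add_neg (√(2 * u + 2 * t ^ 2 - a ^ 2)) t, Real.exp_add]
    ring
  have hm : MonotoneOn
      (fun u => 2 * psi √u - Real.exp (-t) * psi √(2 * u + 2 * t ^ 2 - a ^ 2))
      (Set.Icc (ω ^ 2) (w ^ 2)) := by
    have hpos : ∀ u ∈ interior (Set.Icc (ω ^ 2) (w ^ 2)), 0 < u ∧ u < w ^ 2 := by
      intro u hu
      rw [interior_Icc] at hu
      exact ⟨(sq_nonneg ω).trans_lt hu.1, hu.2⟩
    refine monotoneOn_of_deriv_nonneg (convex_Icc _ _) ?_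
      (fun u hu => (hd u (hpos u hu).1).differentiableAt.differentiableWithinAt) fun u hu => ?_
    · have := continuous_psi
      exact Continuous.continuousOn (by fun_prop)
    · obtain ⟨hu0, huw⟩ := hpos u hu
      rw [(hd u hu0).deriv, sub_nonneg, Real.exp_le_exp, le_sub_iff_add_le]
      have hsw : √u ≤ w := Real.sqrt_le_iff.2 ⟨hω.trans hωw, huw.le⟩
      have hsq := Real.sq_sqrt hu0.le
      have hs0 := Real.sqrt_nonneg u
      apply Real.le_sqrt_of_sq_le
      -- the difference of the two sides is `(t - √u)² - a²`, and `a ≤ t - √u`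
      nlinarith
  have h0 : ω ^ 2 ≤ w ^ 2 := pow_le_pow_left₀ hω hωw 2
  have := hm ⟨le_rfl, h0⟩ ⟨h0, le_rfl⟩ h0
  simp only [Real.sqrt_sq hω, Real.sqrt_sq (hω.trans hωw)] at this
  linarith

/-- For a jump with the midpoint at the top of the strip and one end at the bottom, the midpoint
inequality follows from the extremal case `a = ω`, `t = s`. -/
lemma psi_midpoint_reduce_end {a t ω δ s : ℝ} (hs : 0 ≤ s) (hω : 0 ≤ ω) (hδ : 0 ≤ δ)
    (hδω : δ ^ 2 = ω ^ 2 + 2 * s ^ 2) (hωa : ω ≤ a) (ht : 0 ≤ t)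
    (h : a ^ 2 + δ ^ 2 = 2 * ω ^ 2 + 2 * t ^ 2)
    (hψ : Real.exp s * psi ω + Real.exp (-s) * psi δ = 2 * psi ω) :
    Real.exp t * psi a + Real.exp (-t) * psi δ ≤ 2 * psi ω := by
  have hst : s ≤ t := by nlinarith
  have hd : ∀ x : ℝ, s < x → HasDerivAt
      (fun x => Real.exp x * psi √(ω ^ 2 + 2 * (x ^ 2 - s ^ 2)) + Real.exp (-x) * psi δ)
      (Real.exp (-x) * (psi (√(ω ^ 2 + 2 * (x ^ 2 - s ^ 2)) + 2 * x) - psi δ)) x := by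
    intro x hx
    have hpos : 0 < ω ^ 2 + 2 * (x ^ 2 - s ^ 2) := by nlinarith
    have h1 : HasDerivAt (fun x : ℝ => ω ^ 2 + 2 * (x ^ 2 - s ^ 2)) (4 * x) x := by
      have := ((((hasDerivAt_id x).pow 2).sub_const (s ^ 2)).const_mul 2).const_add (ω ^ 2)
      refine this.congr_deriv ?_
      simp only [id]
      push_cast
      ring
    have h2 := (hasDerivAt_psi_sqrt hpos).comp x h1
    have h3 : HasDerivAt (fun x : ℝ => Real.exp (-x)) (-Real.exp (-x)) x := by
      simpa using (hasDerivAt_neg x).exp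
    have h4 := ((Real.hasDerivAt_exp x).mul h2).add (h3.mul_const (psi δ))
    refine h4.congr_deriv ?_
    have e : Real.exp (-x) * Real.exp (2 * x) = Real.exp x := by
      rw [← Real.exp_add]; ring_nf
    simp only [Function.comp, psi, Real.exp_add]
    linear_combination (-(1 - (√(ω ^ 2 + 2 * (x ^ 2 - s ^ 2)) + 2 * x)) *
      Real.exp √(ω ^ 2 + 2 * (x ^ 2 - s ^ 2))) * e
  have hm : AntitoneOn
      (fun x => Real.exp x * psi √(ω ^ 2 + 2 * (x ^ 2 - s ^ 2)) + Real.exp (-x) * psi δ)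
      (Set.Ici s) := by
    refine antitoneOn_of_deriv_nonpos (convex_Ici s) ?_ (fun x hx => ?_) fun x hx => ?_
    · have := continuous_psi
      exact Continuous.continuousOn (by fun_prop)
    · rw [interior_Ici] at hx
      exact (hd x hx).differentiableAt.differentiableWithinAt
    · rw [interior_Ici] at hx
      have hx' : s < x := hx
      rw [(hd x hx).deriv]
      refine mul_nonpos_of_nonneg_of_nonpos (Real.exp_pos _).le (sub_nonpos.2 ?_)
      have hle : δ ≤ √(ω ^ 2 + 2 * (x ^ 2 - s ^ 2)) + 2 * x := by
        have hω' : ω ≤ √(ω ^ 2 + 2 * (x ^ 2 - s ^ 2)) :=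
          Real.le_sqrt_of_sq_le (by nlinarith)
        have hx0 : 0 ≤ x := hs.trans hx'.le
        have hsq := Real.sq_sqrt (show 0 ≤ ω ^ 2 + 2 * (x ^ 2 - s ^ 2) by nlinarith)
        refine le_of_sq_le_sq ?_ (by positivity)
        nlinarith [mul_nonneg (hω.trans hω') hx0]
      exact antitoneOn_psi (Set.mem_Ici.2 hδ) (Set.mem_Ici.2 (hδ.trans hle)) hle
  have := hm (Set.mem_Ici.2 le_rfl) (Set.mem_Ici.2 hst) hst
  have ea : ω ^ 2 + 2 * (t ^ 2 - s ^ 2) = a ^ 2 := by linarith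
  simp only [sub_self, mul_zero, add_zero, Real.sqrt_sq hω, ea, Real.sqrt_sq (hω.trans hωa)] at this
  linarith

/-- For a large jump with the midpoint at the top of the strip, the defect in the midpoint
inequality is quasi-concave in the jump `t`, so the inequality follows from its validity for the
smallest and for the largest jump. -/
lemma psi_midpoint_quasiconcave {a t t₀ t₁ ω : ℝ} (ha : 0 ≤ a) (hω : 0 ≤ ω)
    (ht₀ : t₀ = ω + a) (h0 : t₀ < t) (h1 : t ≤ t₁)
    (hl : Real.exp t₀ * psi a + Real.exp (-t₀) * psi √(2 * ω ^ 2 + 2 * t₀ ^ 2 - a ^ 2) ≤ 2 * psi ω)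
    (hr : Real.exp t₁ * psi a + Real.exp (-t₁) * psi √(2 * ω ^ 2 + 2 * t₁ ^ 2 - a ^ 2) ≤
      2 * psi ω) :
    Real.exp t * psi a + Real.exp (-t) * psi √(2 * ω ^ 2 + 2 * t ^ 2 - a ^ 2) ≤ 2 * psi ω := by
  set β : ℝ → ℝ := fun x => √(2 * ω ^ 2 + 2 * x ^ 2 - a ^ 2) with hβ
  have hpos : ∀ x, t₀ < x → 0 < 2 * ω ^ 2 + 2 * x ^ 2 - a ^ 2 := fun x hx => by nlinarith
  have hβs : ∀ x, t₀ < x → β x ^ 2 = 2 * ω ^ 2 + 2 * x ^ 2 - a ^ 2 :=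
    fun x hx => Real.sq_sqrt (hpos x hx).le
  have hβ0 : ∀ x, 0 ≤ β x := fun x => Real.sqrt_nonneg _
  have hd : ∀ x : ℝ, t₀ < x → HasDerivAt
      (fun x => Real.exp x * psi a + Real.exp (-x) * psi (β x))
      (Real.exp x * (psi a - psi (β x - 2 * x))) x := by
    intro x hx
    have h1 : HasDerivAt (fun x : ℝ => 2 * ω ^ 2 + 2 * x ^ 2 - a ^ 2) (4 * x) x := by
      have := ((((hasDerivAt_id x).pow 2).const_mul 2).const_add (2 * ω ^ 2)).sub_const (a ^ 2)
      refine this.congr_deriv ?_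
      simp only [id]
      push_cast
      ring
    have h2 := (hasDerivAt_psi_sqrt (hpos x hx)).comp x h1
    have h3 : HasDerivAt (fun x : ℝ => Real.exp (-x)) (-Real.exp (-x)) x := by
      simpa using (hasDerivAt_neg x).exp
    have h4 := ((Real.hasDerivAt_exp x).mul_const (psi a)).add (h3.mul h2)
    refine h4.congr_deriv ?_
    have e : Real.exp x * Real.exp (-(2 * x)) = Real.exp (-x) := by
      rw [← Real.exp_add]; ring_nf
    simp only [Function.comp, psi, hβ, sub_eq_add_neg (√_) (2 * x), Real.exp_add]
    linear_combination ((1 - (√(2 * ω ^ 2 + 2 * x ^ 2 - a ^ 2) - 2 * x)) *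
      Real.exp √(2 * ω ^ 2 + 2 * x ^ 2 - a ^ 2)) * e
  have hc : Continuous (fun x => Real.exp x * psi a + Real.exp (-x) * psi (β x)) := by
    have := continuous_psi
    fun_prop
  -- `β x - 2 x` is nonpositive and decreasing
  have hneg : ∀ x, t₀ < x → β x - 2 * x ≤ 0 := by
    intro x hx
    have := hβs x hx
    have : β x ≤ 2 * x := le_of_sq_le_sq (by nlinarith) (by linarith)
    linarith
  have hdec : ∀ x y, t₀ < x → x ≤ y → β y - 2 * y ≤ β x - 2 * x := by
    intro x y hx hxy
    have ex := hβs x hx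
    have ey := hβs y (hx.trans_le hxy)
    have hxx : x ≤ β x := le_of_sq_le_sq (by nlinarith) (hβ0 x)
    have : β y ≤ β x + 2 * (y - x) :=
      le_of_sq_le_sq (by nlinarith) (by linarith)
    linarith
  have hψdec : ∀ x y, t₀ < x → x ≤ y → psi (β y - 2 * y) ≤ psi (β x - 2 * x) :=
    fun x y hx hxy => monotoneOn_psi (hneg y (hx.trans_le hxy)) (hneg x hx) (hdec x y hx hxy)
  rcases le_total (psi a) (psi (β t - 2 * t)) with hcase | hcase
  · have hm : AntitoneOn (fun x => Real.exp x * psi a + Real.exp (-x) * psi (β x))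
        (Set.Icc t₀ t) := by
      refine antitoneOn_of_deriv_nonpos (convex_Icc _ _) hc.continuousOn (fun x hx => ?_)
        fun x hx => ?_
      · rw [interior_Icc] at hx
        exact (hd x hx.1).differentiableAt.differentiableWithinAt
      · rw [interior_Icc] at hx
        rw [(hd x hx.1).deriv]
        have := hψdec x t hx.1 hx.2.le
        exact mul_nonpos_of_nonneg_of_nonpos (Real.exp_pos _).le (by linarith)
    exact (hm ⟨le_rfl, h0.le⟩ ⟨h0.le, le_rfl⟩ h0.le).trans hl
  · have hm : MonotoneOn (fun x => Real.exp x * psi a + Real.exp (-x) * psi (β x))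
        (Set.Icc t t₁) := by
      refine monotoneOn_of_deriv_nonneg (convex_Icc _ _) hc.continuousOn (fun x hx => ?_)
        fun x hx => ?_
      · rw [interior_Icc] at hx
        exact (hd x (h0.trans hx.1)).differentiableAt.differentiableWithinAt
      · rw [interior_Icc] at hx
        rw [(hd x (h0.trans hx.1)).deriv]
        have := hψdec t x h0 hx.1.le
        exact mul_nonneg (Real.exp_pos _).le (by linarith)
    exact (hm ⟨le_rfl, h1⟩ ⟨h1, le_rfl⟩ h1).trans hr

/-- The midpoint inequality when the half with parameter `a` has the larger mean. If the jump is too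
large for the tangent lines, the midpoint is first moved to the top of the strip. -/
lemma psi_midpoint_of_nonneg {ω δ s a b w t : ℝ} (hs : 0 ≤ s) (hω : 0 ≤ ω) (hδ : 0 ≤ δ)
    (hδω : δ ^ 2 = ω ^ 2 + 2 * s ^ 2)
    (hψ : Real.exp s * psi ω + Real.exp (-s) * psi δ = 2 * psi ω)
    (hωa : ω ≤ a) (hωw : ω ≤ w) (hb0 : 0 ≤ b) (hbδ : b ≤ δ) (ht : 0 ≤ t)
    (h : a ^ 2 + b ^ 2 = 2 * w ^ 2 + 2 * t ^ 2) :
    Real.exp t * psi a + Real.exp (-t) * psi b ≤ 2 * psi w := by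
  have ha : 0 ≤ a := hω.trans hωa
  rcases le_or_gt t (w + a) with hcase | hcase
  · exact psi_midpoint_of_le ha hb0 (hω.trans hωw) ht hcase h
  have eb : 2 * w ^ 2 + 2 * t ^ 2 - a ^ 2 = b ^ 2 := by linarith
  have key := psi_midpoint_reduce_mid hω hωw ha hcase ?_
  · rwa [eb, Real.sqrt_sq hb0] at key
  -- the jump for which the lower end reaches the bottom of the strip
  set t₁ : ℝ := √((δ ^ 2 + a ^ 2) / 2 - ω ^ 2) with ht₁
  have hbδ2 : b ^ 2 ≤ δ ^ 2 := pow_le_pow_left₀ hb0 hbδ 2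
  have hωw2 : ω ^ 2 ≤ w ^ 2 := pow_le_pow_left₀ hω hωw 2
  have ht1sq : t₁ ^ 2 = (δ ^ 2 + a ^ 2) / 2 - ω ^ 2 := Real.sq_sqrt (by nlinarith)
  have ht1 : 0 ≤ t₁ := Real.sqrt_nonneg _
  have htt1 : t ≤ t₁ := Real.le_sqrt_of_sq_le (by linarith)
  refine psi_midpoint_quasiconcave ha hω (t₀ := ω + a) rfl (by linarith) htt1 ?_ ?_
  · refine psi_midpoint_of_le ha (Real.sqrt_nonneg _) hω (by linarith) le_rfl ?_
    rw [Real.sq_sqrt (by nlinarith)]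
    ring
  · have e : 2 * ω ^ 2 + 2 * t₁ ^ 2 - a ^ 2 = δ ^ 2 := by rw [ht1sq]; ring
    rw [e, Real.sqrt_sq hδ]
    exact psi_midpoint_reduce_end hs hω hδ hδω hωa ht1 (by linarith) hψ

/-- The midpoint inequality that makes the Bellman function dyadically concave: here `a`, `b`, `w`
are the parameters `√(δ² - variance)` of the two halves and of the whole interval, and `2t` is the
difference of the means over the halves. -/
lemma psi_midpoint {ω δ s a b w t : ℝ} (hs : 0 ≤ s) (hω : 0 ≤ ω) (hδ : 0 ≤ δ)
    (hδω : δ ^ 2 = ω ^ 2 + 2 * s ^ 2)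
    (hψ : Real.exp s * psi ω + Real.exp (-s) * psi δ = 2 * psi ω)
    (hωa : ω ≤ a) (haδ : a ≤ δ) (hωb : ω ≤ b) (hbδ : b ≤ δ) (hωw : ω ≤ w)
    (h : a ^ 2 + b ^ 2 = 2 * w ^ 2 + 2 * t ^ 2) :
    Real.exp t * psi a + Real.exp (-t) * psi b ≤ 2 * psi w := by
  rcases le_total 0 t with ht | ht
  · exact psi_midpoint_of_nonneg hs hω hδ hδω hψ hωa hωw (hω.trans hωb) hbδ ht h
  · have := psi_midpoint_of_nonneg (t := -t) hs hω hδ hδω hψ hωb hωw (hω.trans hωa) haδ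
      (by linarith) (by linarith)
    rw [neg_neg] at this
    linarith

/-! ### The parameters of the Bellman function -/

lemma mul_exp_le_exp_sub_one {s : ℝ} (hs : 0 ≤ s) :
    s * Real.exp (√2 * s) ≤ (Real.exp s - 1) * Real.exp s := by
  have h1 : s / 2 ≤ Real.sinh (s / 2) := Real.self_le_sinh_iff.2 (by linarith)
  rw [Real.sinh_eq] at h1
  have h2 : √2 * s ≤ s / 2 + s := by
    have : √2 ≤ 3 / 2 := Real.sqrt_le_iff.2 ⟨by norm_num, by norm_num⟩
    nlinarith
  have h3 : s * Real.exp (√2 * s) ≤ s * Real.exp (s / 2 + s) :=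
    mul_le_mul_of_nonneg_left (Real.exp_le_exp.2 h2) hs
  refine h3.trans ?_
  rw [Real.exp_add, ← mul_assoc]
  refine mul_le_mul_of_nonneg_right ?_ (Real.exp_pos s).le
  have e1 : Real.exp (s / 2) * Real.exp (s / 2) = Real.exp s := by rw [← Real.exp_add]; ring_nf
  have e2 : Real.exp (-(s / 2)) * Real.exp (s / 2) = 1 := by rw [← Real.exp_add]; simp
  have := Real.exp_pos (s / 2)
  nlinarith

/-- The sign at the left end in the intermediate value argument that finds `ω`. -/
lemma exp_mul_two_sub_exp_le_psi {s : ℝ} (hs : 0 ≤ s) :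
    Real.exp s * (2 - Real.exp s) ≤ psi (√2 * s) := by
  have hd : ∀ x : ℝ, HasDerivAt (fun x => psi (√2 * x) - Real.exp x * (2 - Real.exp x))
      (2 * ((Real.exp x - 1) * Real.exp x - x * Real.exp (√2 * x))) x := by
    intro x
    have h1 := (hasDerivAt_psi (√2 * x)).comp x ((hasDerivAt_id x).const_mul √2)
    have h2 := (Real.hasDerivAt_exp x).mul ((Real.hasDerivAt_exp x).const_sub 2)
    refine (h1.sub h2).congr_deriv ?_
    have : √2 * √2 = (2 : ℝ) := Real.mul_self_sqrt (by norm_num)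
    linear_combination (-(x * Real.exp (√2 * x))) * this
  have hm : MonotoneOn (fun x => psi (√2 * x) - Real.exp x * (2 - Real.exp x)) (Set.Ici 0) := by
    refine monotoneOn_of_deriv_nonneg (convex_Ici 0)
      (fun x _ => (hd x).continuousAt.continuousWithinAt)
      (fun x _ => (hd x).differentiableAt.differentiableWithinAt) fun x hx => ?_
    rw [interior_Ici] at hx
    rw [(hd x).deriv]
    have := mul_exp_le_exp_sub_one (le_of_lt hx)
    linarith
  have := hm (Set.mem_Ici.2 le_rfl) (Set.mem_Ici.2 hs) hs
  simp only [mul_zero, psi_zero, Real.exp_zero] at this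
  linarith

/-- Existence of the parameters of the Bellman function: it is locally concave on the strip where
the variance is at most `δ²`, and the equation says that the midpoint inequality is an equality
for the extremal jump, from the top of the strip to the top and to the bottom. -/
lemma exists_bellman_parameters {s : ℝ} (hs : 0 ≤ s) (hs2 : s < Real.log 2) :
    ∃ ω δ : ℝ, 0 ≤ ω ∧ 0 ≤ δ ∧ δ < 1 ∧ δ ^ 2 = ω ^ 2 + 2 * s ^ 2 ∧
      Real.exp s * psi ω + Real.exp (-s) * psi δ = 2 * psi ω := by
  rcases hs.eq_or_lt with rfl | hspos
  · refine ⟨0, 0, le_rfl, le_rfl, zero_lt_one, by norm_num, ?_⟩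
    rw [neg_zero, Real.exp_zero]
    ring
  have hexp : Real.exp s < 2 := by
    rwa [← Real.lt_log_iff_exp_lt (by norm_num)]
  have hlog := Real.log_two_lt_d9
  have h2s : 2 * s ^ 2 < 1 := by nlinarith
  set r : ℝ := √(1 - 2 * s ^ 2) with hr
  have hr0 : 0 ≤ r := Real.sqrt_nonneg _
  have hrsq : r ^ 2 = 1 - 2 * s ^ 2 := Real.sq_sqrt (by linarith)
  have hk : 0 < Real.exp s * (2 - Real.exp s) := mul_pos (Real.exp_pos s) (by linarith)
  have hcont : Continuous fun x : ℝ =>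
      Real.exp s * (2 - Real.exp s) * psi x - psi √(x ^ 2 + 2 * s ^ 2) := by
    have := continuous_psi
    fun_prop
  obtain ⟨ω, ⟨hω0, hωr⟩, hω⟩ := intermediate_value_Icc hr0 hcont.continuousOn (show (0 : ℝ) ∈ _ by
    constructor
    · have e : √((0 : ℝ) ^ 2 + 2 * s ^ 2) = √2 * s := by
        rw [zero_pow two_ne_zero, zero_add, Real.sqrt_mul (by norm_num), Real.sqrt_sq hs]
      simp only [e, psi_zero, mul_one]
      linarith [exp_mul_two_sub_exp_le_psi hs]
    · have e : √(r ^ 2 + 2 * s ^ 2) = 1 := by rw [hrsq]; simp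
      have hr1 : 0 ≤ psi r := by
        have : r ≤ 1 := by nlinarith
        exact mul_nonneg (by linarith) (Real.exp_pos r).le
      simp only [e]
      have : psi 1 = 0 := by simp [psi]
      rw [this, sub_zero]
      exact mul_nonneg hk.le hr1)
  have hδsq : √(ω ^ 2 + 2 * s ^ 2) ^ 2 = ω ^ 2 + 2 * s ^ 2 := Real.sq_sqrt (by positivity)
  have heq : psi √(ω ^ 2 + 2 * s ^ 2) = Real.exp s * (2 - Real.exp s) * psi ω := by
    simp only at hω
    linarith
  have hee : Real.exp (-s) * Real.exp s = 1 := by rw [← Real.exp_add]; simp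
  have hω2 : ω ^ 2 ≤ r ^ 2 := pow_le_pow_left₀ hω0 hωr 2
  refine ⟨ω, √(ω ^ 2 + 2 * s ^ 2), hω0, Real.sqrt_nonneg _, ?_, hδsq, ?_⟩
  · refine lt_of_le_of_ne (Real.sqrt_le_iff.2 ⟨zero_le_one, by linarith⟩) fun h1 => ?_
    have h0 : psi √(ω ^ 2 + 2 * s ^ 2) = 0 := by rw [h1]; simp [psi]
    rw [h0] at heq
    have hψ0 : psi ω = 0 := by
      rcases mul_eq_zero.1 heq.symm with h | h
      · exact absurd h hk.ne'
      · exact h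
    have hω1 : ω = 1 := by
      unfold psi at hψ0
      rcases mul_eq_zero.1 hψ0 with h | h
      · linarith
      · exact absurd h (Real.exp_pos ω).ne'
    -- `ω = 1` would force `r = 1`, so `s = 0`
    nlinarith
  · rw [heq]
    linear_combination ((2 - Real.exp s) * psi ω) * hee

/-! ### Means and variances over dyadic intervals -/

lemma dyadicInterval_gen_zero (c d : ℝ) (m : Fin (2 ^ 0)) :
    dyadicInterval c d 0 m = Set.Ioc c d := by
  simp [dyadicInterval]

lemma dyadicInterval_left_half (c d : ℝ) (n : ℕ) (m : Fin (2 ^ n)) :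
    dyadicInterval c ((c + d) / 2) n m =
      dyadicInterval c d (n + 1) ⟨m, by have := m.2; rw [pow_succ]; omega⟩ := by
  simp only [dyadicInterval]
  congr 1 <;> (field_simp; ring)

lemma dyadicInterval_right_half (c d : ℝ) (n : ℕ) (m : Fin (2 ^ n)) :
    dyadicInterval ((c + d) / 2) d n m =
      dyadicInterval c d (n + 1) ⟨m + 2 ^ n, by have := m.2; rw [pow_succ]; omega⟩ := by
  simp only [dyadicInterval]
  push_cast
  congr 1 <;> (field_simp; ring)

lemma setAverage_Ioc {c d : ℝ} (hcd : c < d) (f : ℝ → ℝ) :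
    ⨍ x in Set.Ioc c d, f x = (d - c)⁻¹ * ∫ x in Set.Ioc c d, f x := by
  rw [setAverage_eq, Measure.real, Real.volume_Ioc, ENNReal.toReal_ofReal (by linarith),
    smul_eq_mul]

lemma setIntegral_Ioc_eq {c d : ℝ} (hcd : c < d) (f : ℝ → ℝ) :
    ∫ x in Set.Ioc c d, f x = (d - c) * ⨍ x in Set.Ioc c d, f x := by
  rw [setAverage_Ioc hcd, mul_inv_cancel_left₀ (by linarith)]

/-- The variance of `φ` over the interval `(c, d]`, as a real number. -/
noncomputable def intervalVar (φ : ℝ → ℝ) (c d : ℝ) : ℝ :=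
  ⨍ x in Set.Ioc c d, (φ x - ⨍ y in Set.Ioc c d, φ y) ^ 2

lemma intervalVar_nonneg (φ : ℝ → ℝ) {c d : ℝ} (hcd : c < d) : 0 ≤ intervalVar φ c d := by
  rw [intervalVar, setAverage_Ioc hcd]
  exact mul_nonneg (inv_nonneg.2 (by linarith)) (integral_nonneg fun x => sq_nonneg _)

lemma meanSqOsc_eq_ofReal_intervalVar {φ : ℝ → ℝ} {c d : ℝ} (hcd : c < d)
    (h : IntegrableOn (fun x => (φ x - ⨍ y in Set.Ioc c d, φ y) ^ 2) (Set.Ioc c d)) :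
    meanSqOsc φ (Set.Ioc c d) = ENNReal.ofReal (intervalVar φ c d) := by
  rw [meanSqOsc, setLAverage_eq, Real.volume_Ioc,
    ← ofReal_integral_eq_lintegral_ofReal h (ae_of_all _ fun x => sq_nonneg _),
    ← ENNReal.ofReal_div_of_pos (by linarith), intervalVar,
    setAverage_Ioc hcd (fun x => (φ x - ⨍ y in Set.Ioc c d, φ y) ^ 2), div_eq_inv_mul]

/-- `φ` is integrable on `(c, d]` and has mean square oscillation at most `r` on all its dyadic
subintervals. -/
def DyadicOscLE (r : ℝ) (φ : ℝ → ℝ) (c d : ℝ) : Prop :=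
  IntegrableOn φ (Set.Ioc c d) ∧
    ∀ (n : ℕ) (m : Fin (2 ^ n)), meanSqOsc φ (dyadicInterval c d n m) ≤ ENNReal.ofReal r

lemma mem_dyadicBMOBall_iff {a b ε : ℝ} (hε : 0 ≤ ε) (φ : ℝ → ℝ) :
    φ ∈ dyadicBMOBall a b ε ↔ DyadicOscLE (ε ^ 2) φ a b := by
  have key : dyadicBMONorm a b φ ≤ ENNReal.ofReal ε ↔
      (⨆ (n : ℕ) (m : Fin (2 ^ n)), meanSqOsc φ (dyadicInterval a b n m)) ≤
        ENNReal.ofReal (ε ^ 2) := by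
    rw [dyadicBMONorm, one_div, ENNReal.rpow_inv_le_iff two_pos, ENNReal.ofReal_pow hε]
    norm_num
  rw [dyadicBMOBall, Set.mem_ofPred_eq, key, DyadicOscLE, iSup_le_iff]
  simp only [iSup_le_iff]

namespace DyadicOscLE

variable {r : ℝ} {φ : ℝ → ℝ} {c d : ℝ}

lemma left_half (h : DyadicOscLE r φ c d) (hcd : c < d) : DyadicOscLE r φ c ((c + d) / 2) := by
  refine ⟨h.1.mono_set (Set.Ioc_subset_Ioc_right (by linarith)), fun n m => ?_⟩
  rw [dyadicInterval_left_half]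
  exact h.2 _ _

lemma right_half (h : DyadicOscLE r φ c d) (hcd : c < d) : DyadicOscLE r φ ((c + d) / 2) d := by
  refine ⟨h.1.mono_set (Set.Ioc_subset_Ioc_left (by linarith)), fun n m => ?_⟩
  rw [dyadicInterval_right_half]
  exact h.2 _ _

lemma meanSqOsc_le (h : DyadicOscLE r φ c d) :
    meanSqOsc φ (Set.Ioc c d) ≤ ENNReal.ofReal r := by
  have := h.2 0 0
  rwa [dyadicInterval_gen_zero] at this

lemma integrableOn_sq (h : DyadicOscLE r φ c d) :
    IntegrableOn (fun x => (φ x - ⨍ y in Set.Ioc c d, φ y) ^ 2) (Set.Ioc c d) := by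
  have hm : AEStronglyMeasurable (fun x => (φ x - ⨍ y in Set.Ioc c d, φ y) ^ 2)
      (volume.restrict (Set.Ioc c d)) :=
    (h.1.aestronglyMeasurable.sub aestronglyMeasurable_const).pow 2
  refine ⟨hm, (hasFiniteIntegral_iff_ofReal (ae_of_all _ fun x => sq_nonneg _)).2 ?_⟩
  have h1 := h.meanSqOsc_le
  rw [meanSqOsc, setLAverage_eq, Real.volume_Ioc] at h1
  by_contra htop
  rw [not_lt, top_le_iff] at htop
  rw [htop, ENNReal.top_div_of_ne_top ENNReal.ofReal_ne_top, top_le_iff] at h1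
  exact ENNReal.ofReal_ne_top h1

lemma intervalVar_le (h : DyadicOscLE r φ c d) (hr : 0 ≤ r) (hcd : c < d) :
    intervalVar φ c d ≤ r := by
  have := h.meanSqOsc_le
  rwa [meanSqOsc_eq_ofReal_intervalVar hcd (h.integrableOn_sq),
    ENNReal.ofReal_le_ofReal_iff hr] at this

end DyadicOscLE

lemma setIntegral_Ioc_split {f : ℝ → ℝ} {c d : ℝ} (hcd : c < d)
    (hf : IntegrableOn f (Set.Ioc c d)) :
    ∫ x in Set.Ioc c d, f x =
      (∫ x in Set.Ioc c ((c + d) / 2), f x) + ∫ x in Set.Ioc ((c + d) / 2) d, f x := by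
  have h1 : c ≤ (c + d) / 2 := by linarith
  have h2 : (c + d) / 2 ≤ d := by linarith
  rw [← Set.Ioc_union_Ioc_eq_Ioc h1 h2]
  exact setIntegral_union (Set.Ioc_disjoint_Ioc_of_le le_rfl) measurableSet_Ioc
    (hf.mono_set (Set.Ioc_subset_Ioc_right h2)) (hf.mono_set (Set.Ioc_subset_Ioc_left h1))

lemma setAverage_Ioc_split {f : ℝ → ℝ} {c d : ℝ} (hcd : c < d)
    (hf : IntegrableOn f (Set.Ioc c d)) :
    ⨍ x in Set.Ioc c d, f x =
      ((⨍ x in Set.Ioc c ((c + d) / 2), f x) + ⨍ x in Set.Ioc ((c + d) / 2) d, f x) / 2 := by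
  rw [setAverage_Ioc hcd, setAverage_Ioc (show c < (c + d) / 2 by linarith),
    setAverage_Ioc (show (c + d) / 2 < d by linarith), setIntegral_Ioc_split hcd hf]
  have : d - c ≠ 0 := by linarith
  have e1 : (c + d) / 2 - c = (d - c) / 2 := by ring
  have e2 : d - (c + d) / 2 = (d - c) / 2 := by ring
  rw [e1, e2]
  field_simp

lemma setAverage_Ioc_sq_sub {φ : ℝ → ℝ} {c d : ℝ} (hcd : c < d) (hφ : IntegrableOn φ (Set.Ioc c d))
    (h2 : IntegrableOn (fun x => (φ x - ⨍ y in Set.Ioc c d, φ y) ^ 2) (Set.Ioc c d)) (k : ℝ) :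
    ⨍ x in Set.Ioc c d, (φ x - k) ^ 2 =
      intervalVar φ c d + ((⨍ y in Set.Ioc c d, φ y) - k) ^ 2 := by
  set e : ℝ := ⨍ y in Set.Ioc c d, φ y with he
  have hexp : ∀ x, (φ x - k) ^ 2 = (φ x - e) ^ 2 + (2 * (e - k) * φ x + (k ^ 2 - e ^ 2)) :=
    fun x => by ring
  have hc : IntegrableOn (fun _ : ℝ => k ^ 2 - e ^ 2) (Set.Ioc c d) :=
    integrableOn_const (by simp)
  have hint : IntegrableOn (fun x => 2 * (e - k) * φ x + (k ^ 2 - e ^ 2)) (Set.Ioc c d) :=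
    (hφ.const_mul _).add hc
  have hd : d - c ≠ 0 := by linarith
  rw [intervalVar, ← he, setAverage_Ioc hcd, setAverage_Ioc hcd]
  simp only [hexp]
  rw [integral_add h2 hint, integral_add (hφ.const_mul _) hc, integral_const_mul,
    setIntegral_Ioc_eq hcd φ, ← he, setIntegral_const, Measure.real, Real.volume_Ioc,
    ENNReal.toReal_ofReal (by linarith), smul_eq_mul]
  field_simp
  ring

/-- The variance over an interval in terms of the means and the variances over its halves. -/
lemma intervalVar_split {r : ℝ} {φ : ℝ → ℝ} {c d : ℝ} (hcd : c < d) (h : DyadicOscLE r φ c d) :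
    intervalVar φ c d =
      (intervalVar φ c ((c + d) / 2) + intervalVar φ ((c + d) / 2) d) / 2 +
        (((⨍ x in Set.Ioc ((c + d) / 2) d, φ x) -
          ⨍ x in Set.Ioc c ((c + d) / 2), φ x) / 2) ^ 2 := by
  have h1 : c < (c + d) / 2 := by linarith
  have h2 : (c + d) / 2 < d := by linarith
  rw [intervalVar, setAverage_Ioc_split hcd (h.integrableOn_sq),
    setAverage_Ioc_sq_sub h1 (h.left_half hcd).1 ((h.left_half hcd).integrableOn_sq),
    setAverage_Ioc_sq_sub h2 (h.right_half hcd).1 ((h.right_half hcd).integrableOn_sq),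
    setAverage_Ioc_split hcd h.1]
  ring

/-! ### Dyadic means and Bellman induction -/

/-- `dyadicMean φ n c d x` is the mean of `φ` over the dyadic subinterval of `(c, d]` of
generation `n` that contains `x`. -/
noncomputable def dyadicMean (φ : ℝ → ℝ) : ℕ → ℝ → ℝ → ℝ → ℝ
  | 0, c, d, _ => ⨍ y in Set.Ioc c d, φ y
  | n + 1, c, d, x =>
    if x ≤ (c + d) / 2 then dyadicMean φ n c ((c + d) / 2) x
    else dyadicMean φ n ((c + d) / 2) d x

lemma measurable_dyadicMean (φ : ℝ → ℝ) (n : ℕ) (c d : ℝ) : Measurable (dyadicMean φ n c d) := by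
  induction n generalizing c d with
  | zero => exact measurable_const
  | succ n ih => exact Measurable.ite measurableSet_Iic (ih _ _) (ih _ _)

lemma dyadicMean_eq_setAverage (φ : ℝ → ℝ) (n : ℕ) {c d x : ℝ} (hx : x ∈ Set.Ioc c d) :
    ∃ c' d' : ℝ, x ∈ Set.Ioc c' d' ∧ d' - c' = (d - c) / 2 ^ n ∧
      Set.Ioc c' d' ⊆ Set.Ioc c d ∧ dyadicMean φ n c d x = ⨍ y in Set.Ioc c' d', φ y := by
  induction n generalizing c d with
  | zero => exact ⟨c, d, hx, by simp, subset_rfl, rfl⟩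
  | succ n ih =>
    have hcd : c < d := hx.1.trans_le hx.2
    by_cases h : x ≤ (c + d) / 2
    · obtain ⟨c', d', h1, h2, h3, h4⟩ := ih (c := c) (d := (c + d) / 2) ⟨hx.1, h⟩
      refine ⟨c', d', h1, ?_, h3.trans (Set.Ioc_subset_Ioc_right (by linarith)), ?_⟩
      · rw [h2, pow_succ]; field_simp; ring
      · rw [dyadicMean, if_pos h, h4]
    · obtain ⟨c', d', h1, h2, h3, h4⟩ := ih (c := (c + d) / 2) (d := d) ⟨not_le.1 h, hx.2⟩
      refine ⟨c', d', h1, ?_, h3.trans (Set.Ioc_subset_Ioc_left (by linarith)), ?_⟩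
      · rw [h2, pow_succ]; field_simp; ring
      · rw [dyadicMean, if_neg h, h4]

/-- Lebesgue's differentiation theorem along the dyadic lattice. -/
lemma ae_tendsto_dyadicMean {φ : ℝ → ℝ} {c d : ℝ} (hφ : IntegrableOn φ (Set.Ioc c d)) :
    ∀ᵐ x ∂volume.restrict (Set.Ioc c d),
      Tendsto (fun n => dyadicMean φ n c d x) atTop (𝓝 (φ x)) := by
  have hint : Integrable ((Set.Ioc c d).indicator φ) :=
    (integrable_indicator_iff measurableSet_Ioc).2 hφ
  have hL := IsUnifLocDoublingMeasure.ae_tendsto_average (volume : Measure ℝ)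
    hint.locallyIntegrable 1
  rw [ae_restrict_iff' measurableSet_Ioc]
  filter_upwards [hL] with x hx hxI
  have hcd : c < d := hxI.1.trans_le hxI.2
  choose u v huv hlen hsub hmean using fun n => dyadicMean_eq_setAverage φ n hxI
  have hball : ∀ n, Metric.closedBall ((u n + v n) / 2) ((d - c) / 2 ^ n / 2) =
      Set.Icc (u n) (v n) := by
    intro n
    rw [Real.closedBall_eq_Icc, ← hlen n]
    congr 1 <;> ring
  have h1 := @hx ℕ atTop (fun n => (u n + v n) / 2) (fun n => (d - c) / 2 ^ n / 2) ?_ ?_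
  · rw [Set.indicator_of_mem hxI] at h1
    refine h1.congr fun n => ?_
    rw [hmean n, hball n, setAverage_congr Ioc_ae_eq_Icc.symm]
    refine setAverage_congr_fun measurableSet_Ioc (ae_of_all _ fun y hy => ?_)
    exact Set.indicator_of_mem (hsub n hy) φ
  · refine tendsto_nhdsWithin_iff.2 ⟨?_, Eventually.of_forall fun n => ?_⟩
    · have := (tendsto_pow_atTop_nhds_zero_of_lt_one (r := (1 / 2 : ℝ)) (by norm_num)
        (by norm_num)).const_mul ((d - c) / 2)
      rw [mul_zero] at this
      refine this.congr fun n => ?_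
      rw [one_div, inv_pow]
      ring
    · exact Set.mem_Ioi.2 (by have : 0 < d - c := by linarith
                              positivity)
  · refine Eventually.of_forall fun n => ?_
    simp only [one_mul]
    rw [hball n]
    exact ⟨(huv n).1.le, (huv n).2⟩

/-- Bellman induction on the generation: the integral of the exponential of the dyadic means is
at most the value of the Bellman function at the mean and the variance of `φ`. -/
lemma lintegral_exp_dyadicMean_le {ω δ s : ℝ} (hs : 0 ≤ s) (hω : 0 ≤ ω) (hδ : 0 ≤ δ) (hδ1 : δ < 1)
    (hδω : δ ^ 2 = ω ^ 2 + 2 * s ^ 2)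
    (hψ : Real.exp s * psi ω + Real.exp (-s) * psi δ = 2 * psi ω)
    {φ : ℝ → ℝ} (n : ℕ) {c d : ℝ} (hcd : c < d) (h : DyadicOscLE (2 * s ^ 2) φ c d) :
    ∫⁻ x in Set.Ioc c d, ENNReal.ofReal (Real.exp (dyadicMean φ n c d x)) ≤
      ENNReal.ofReal ((d - c) * (Real.exp (⨍ x in Set.Ioc c d, φ x) *
        psi √(δ ^ 2 - intervalVar φ c d) / psi δ)) := by
  have hψδ : 0 < psi δ := psi_pos hδ1
  have hr : 0 ≤ 2 * s ^ 2 := by positivity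
  induction n generalizing c d with
  | zero =>
    simp only [dyadicMean]
    rw [setLIntegral_const, Real.volume_Ioc, ← ENNReal.ofReal_mul (Real.exp_pos _).le, mul_comm]
    refine ENNReal.ofReal_le_ofReal (mul_le_mul_of_nonneg_left ?_ (by linarith))
    rw [mul_div_assoc]
    refine le_mul_of_one_le_right (Real.exp_pos _).le ((one_le_div hψδ).2 ?_)
    have hle : √(δ ^ 2 - intervalVar φ c d) ≤ δ :=
      Real.sqrt_le_iff.2 ⟨hδ, by linarith [intervalVar_nonneg φ hcd]⟩
    exact antitoneOn_psi (Set.mem_Ici.2 (Real.sqrt_nonneg _)) (Set.mem_Ici.2 hδ) hle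
  | succ n ih =>
    have h1 : c < (c + d) / 2 := by linarith
    have h2 : (c + d) / 2 < d := by linarith
    have hL := h.left_half hcd
    have hR := h.right_half hcd
    have ihL := ih h1 hL
    have ihR := ih h2 hR
    have hsplit : ∫⁻ x in Set.Ioc c d, ENNReal.ofReal (Real.exp (dyadicMean φ (n + 1) c d x)) =
        (∫⁻ x in Set.Ioc c ((c + d) / 2),
          ENNReal.ofReal (Real.exp (dyadicMean φ n c ((c + d) / 2) x))) +
        ∫⁻ x in Set.Ioc ((c + d) / 2) d,
          ENNReal.ofReal (Real.exp (dyadicMean φ n ((c + d) / 2) d x)) := by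
      rw [← Set.Ioc_union_Ioc_eq_Ioc h1.le h2.le,
        lintegral_union measurableSet_Ioc (Set.Ioc_disjoint_Ioc_of_le le_rfl)]
      congr 1
      · refine setLIntegral_congr_fun measurableSet_Ioc fun x hx => ?_
        simp only [dyadicMean, if_pos hx.2]
      · refine setLIntegral_congr_fun measurableSet_Ioc fun x hx => ?_
        simp only [dyadicMean, if_neg (not_le.2 hx.1)]
    have hvar := intervalVar_split hcd h
    have hmean := setAverage_Ioc_split hcd h.1
    set X : ℝ := ⨍ x in Set.Ioc c d, φ x
    set XL : ℝ := ⨍ x in Set.Ioc c ((c + d) / 2), φ x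
    set XR : ℝ := ⨍ x in Set.Ioc ((c + d) / 2) d, φ x
    have hw : ∀ V : ℝ, V ≤ 2 * s ^ 2 → ω ≤ √(δ ^ 2 - V) ∧ √(δ ^ 2 - V) ^ 2 = δ ^ 2 - V :=
      fun V hV => ⟨Real.le_sqrt_of_sq_le (by linarith), Real.sq_sqrt (by nlinarith)⟩
    have hw' : ∀ V : ℝ, 0 ≤ V → √(δ ^ 2 - V) ≤ δ :=
      fun V hV => Real.sqrt_le_iff.2 ⟨hδ, by linarith⟩
    obtain ⟨w1, w2⟩ := hw _ (h.intervalVar_le hr hcd)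
    obtain ⟨a1, a2⟩ := hw _ (hR.intervalVar_le hr h2)
    obtain ⟨b1, b2⟩ := hw _ (hL.intervalVar_le hr h1)
    have a3 := hw' _ (intervalVar_nonneg φ h2)
    have b3 := hw' _ (intervalVar_nonneg φ h1)
    -- the half difference of the means is the jump; the right half has mean `X + t`
    have key := psi_midpoint (t := (XR - XL) / 2) hs hω hδ hδω hψ a1 a3 b1 b3 w1
      (by rw [a2, b2, w2, hvar]; ring)
    have nonneg : ∀ x V : ℝ, 0 ≤ V → 0 ≤ Real.exp x * psi √(δ ^ 2 - V) / psi δ := fun x V hV =>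
      div_nonneg (mul_nonneg (Real.exp_pos _).le
        (psi_pos ((hw' V hV).trans_lt hδ1)).le) hψδ.le
    rw [hsplit]
    refine (add_le_add ihL ihR).trans ?_
    rw [← ENNReal.ofReal_add
      (mul_nonneg (by linarith) (nonneg _ _ (intervalVar_nonneg φ h1)))
      (mul_nonneg (by linarith) (nonneg _ _ (intervalVar_nonneg φ h2)))]
    refine ENNReal.ofReal_le_ofReal ?_
    have eR : Real.exp XR = Real.exp X * Real.exp ((XR - XL) / 2) := by
      rw [← Real.exp_add, hmean]; ring_nf
    have eL : Real.exp XL = Real.exp X * Real.exp (-((XR - XL) / 2)) := by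
      rw [← Real.exp_add, hmean]; ring_nf
    rw [eR, eL]
    have hfac : 0 ≤ (d - c) / 2 * Real.exp X / psi δ :=
      div_nonneg (mul_nonneg (by linarith) (Real.exp_pos _).le) hψδ.le
    have := mul_le_mul_of_nonneg_left key hfac
    refine le_trans (le_of_eq ?_) (this.trans (le_of_eq ?_)) <;> ring

/-- The integral form of the dyadic John–Nirenberg inequality. -/
lemma exp_integral_le {s : ℝ} (hs : 0 ≤ s) (hs2 : s < Real.log 2) {φ : ℝ → ℝ} {a b : ℝ}
    (hab : a < b) (h : DyadicOscLE (2 * s ^ 2) φ a b) :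
    IntegrableOn (fun x => Real.exp (φ x)) (Set.Ioc a b) ∧
      ⨍ x in Set.Ioc a b, Real.exp (φ x) ≤
        Real.exp (-s) / (2 - Real.exp s) * Real.exp (⨍ x in Set.Ioc a b, φ x) := by
  obtain ⟨ω, δ, hω, hδ, hδ1, hδω, hψ⟩ := exists_bellman_parameters hs hs2
  have hψδ : 0 < psi δ := psi_pos hδ1
  have hexp : Real.exp s < 2 := by rwa [← Real.lt_log_iff_exp_lt (by norm_num)]
  set C : ℝ := Real.exp (-s) / (2 - Real.exp s) with hC
  set X : ℝ := ⨍ x in Set.Ioc a b, φ x with hX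
  have hratio : psi ω / psi δ = C := by
    rw [hC, div_eq_div_iff hψδ.ne' (by linarith)]
    linarith
  have hC0 : 0 < C := div_pos (Real.exp_pos _) (by linarith)
  have hbound : ∀ n, ∫⁻ x in Set.Ioc a b, ENNReal.ofReal (Real.exp (dyadicMean φ n a b x)) ≤
      ENNReal.ofReal ((b - a) * (C * Real.exp X)) := by
    intro n
    refine (lintegral_exp_dyadicMean_le hs hω hδ hδ1 hδω hψ n hab h).trans
      (ENNReal.ofReal_le_ofReal (mul_le_mul_of_nonneg_left ?_ (by linarith)))
    have hle : ω ≤ √(δ ^ 2 - intervalVar φ a b) :=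
      Real.le_sqrt_of_sq_le (by linarith [h.intervalVar_le (by positivity) hab])
    have h1 := antitoneOn_psi (Set.mem_Ici.2 hω) (Set.mem_Ici.2 (hω.trans hle)) hle
    rw [← hratio, mul_div_assoc, mul_comm (psi ω / psi δ)]
    exact mul_le_mul_of_nonneg_left (div_le_div_of_nonneg_right h1 hψδ.le) (Real.exp_pos _).le
  have hfatou : ∫⁻ x in Set.Ioc a b, ENNReal.ofReal (Real.exp (φ x)) ≤
      ENNReal.ofReal ((b - a) * (C * Real.exp X)) := by
    calc ∫⁻ x in Set.Ioc a b, ENNReal.ofReal (Real.exp (φ x))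
        = ∫⁻ x in Set.Ioc a b,
            liminf (fun n => ENNReal.ofReal (Real.exp (dyadicMean φ n a b x))) atTop := by
          refine lintegral_congr_ae ?_
          filter_upwards [ae_tendsto_dyadicMean h.1] with x hx
          exact ((ENNReal.tendsto_ofReal
            ((Real.continuous_exp.tendsto _).comp hx)).liminf_eq).symm
      _ ≤ liminf (fun n => ∫⁻ x in Set.Ioc a b,
            ENNReal.ofReal (Real.exp (dyadicMean φ n a b x))) atTop :=
          lintegral_liminf_le fun n =>
            (Real.measurable_exp.comp (measurable_dyadicMean φ n a b)).ennreal_ofReal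
      _ ≤ ENNReal.ofReal ((b - a) * (C * Real.exp X)) := by
          refine (liminf_le_liminf (Eventually.of_forall hbound)).trans ?_
          rw [liminf_const]
  have hint : IntegrableOn (fun x => Real.exp (φ x)) (Set.Ioc a b) := by
    refine ⟨Real.continuous_exp.comp_aestronglyMeasurable h.1.aestronglyMeasurable,
      (hasFiniteIntegral_iff_ofReal (ae_of_all _ fun x => (Real.exp_pos _).le)).2 ?_⟩
    exact hfatou.trans_lt ENNReal.ofReal_lt_top
  refine ⟨hint, ?_⟩
  rw [← ofReal_integral_eq_lintegral_ofReal hint (ae_of_all _ fun x => (Real.exp_pos _).le),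
    ENNReal.ofReal_le_ofReal_iff
      (mul_nonneg (by linarith) (mul_nonneg hC0.le (Real.exp_pos _).le))] at hfatou
  rw [setAverage_Ioc hab, inv_mul_le_iff₀ (by linarith)]
  exact hfatou

/-! ### The extremal staircase -/

/-- The extremal function: a logarithmic staircase on `(a, b]`, with the value `(k - 1) s` at the
points whose relative position in `(a, b]` lies in `(2⁻ᵏ⁻¹, 2⁻ᵏ]`. -/
noncomputable def staircase (s a b x : ℝ) : ℝ := s * (⌊-Real.logb 2 ((x - a) / (b - a))⌋ - 1)

lemma measurable_staircase (s a b : ℝ) : Measurable (staircase s a b) := by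
  have h : Measurable fun x : ℝ => ⌊-Real.logb 2 ((x - a) / (b - a))⌋ := by
    unfold Real.logb
    exact Int.measurable_floor.comp
      (((Real.measurable_log.comp ((measurable_id.sub_const a).div_const _)).div_const _).neg)
  exact ((measurable_from_top.comp h).sub_const 1).const_mul s

lemma staircase_left_half {s a b x : ℝ} (hx : x ∈ Set.Ioc a ((a + b) / 2)) :
    staircase s a b x = staircase s a ((a + b) / 2) x + s := by
  have h1 : a < (a + b) / 2 := hx.1.trans_le hx.2
  have hpos : 0 < (x - a) / (b - a) := div_pos (by linarith [hx.1]) (by linarith)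
  have e : (x - a) / ((a + b) / 2 - a) = 2 * ((x - a) / (b - a)) := by
    have : b - a ≠ 0 := by linarith
    have e1 : (a + b) / 2 - a = (b - a) / 2 := by ring
    rw [e1]
    field_simp
  rw [staircase, staircase, e, Real.logb_mul two_ne_zero hpos.ne',
    Real.logb_self_eq_one one_lt_two]
  have e2 : -(1 + Real.logb 2 ((x - a) / (b - a))) =
      -Real.logb 2 ((x - a) / (b - a)) - (1 : ℤ) := by push_cast; ring
  rw [e2, Int.floor_sub_intCast]
  push_cast
  ring

lemma staircase_right_half {s a b x : ℝ} (hx : x ∈ Set.Ioc ((a + b) / 2) b) :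
    staircase s a b x = -s := by
  have h1 : (a + b) / 2 < b := hx.1.trans_le hx.2
  have hb : 0 < b - a := by linarith
  have hlo : 2⁻¹ < (x - a) / (b - a) := by rw [lt_div_iff₀ hb]; linarith [hx.1]
  have hhi : (x - a) / (b - a) ≤ 1 := by rw [div_le_one hb]; linarith [hx.2]
  have hpos : 0 < (x - a) / (b - a) := lt_trans (by norm_num) hlo
  have hfl : ⌊-Real.logb 2 ((x - a) / (b - a))⌋ = 0 := by
    rw [Int.floor_eq_zero_iff]
    constructor
    · have := Real.logb_nonpos one_lt_two hpos.le hhi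
      linarith
    · have := Real.logb_lt_logb one_lt_two (by norm_num) hlo
      rw [Real.logb_inv, Real.logb_self_eq_one one_lt_two] at this
      linarith
  rw [staircase, hfl]
  simp

lemma integrableOn_rpow_div {a b q : ℝ} (hab : a < b) (hq : -1 < q) :
    IntegrableOn (fun x => ((x - a) / (b - a)) ^ q) (Set.Ioc a b) := by
  have h := (intervalIntegral.intervalIntegrable_rpow' (a := 0) (b := b - a) hq).comp_sub_right a
  rw [zero_add, sub_add_cancel, intervalIntegrable_iff_integrableOn_Ioc_of_le hab.le] at h
  have h' : IntegrableOn (fun x => (x - a) ^ q * ((b - a) ^ q)⁻¹) (Set.Ioc a b) :=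
    Integrable.mul_const h _
  refine h'.congr_fun (fun x hx => ?_) measurableSet_Ioc
  simp only
  rw [Real.div_rpow (by linarith [hx.1]) (by linarith), div_eq_mul_inv]

/-- The exponential of the staircase is dominated by a power of the relative position, of exponent
`-s / log 2 > -1`. -/
lemma integrableOn_exp_staircase {s a b : ℝ} (hs : 0 ≤ s) (hs2 : s < Real.log 2) (hab : a < b) :
    IntegrableOn (fun x => Real.exp (staircase s a b x)) (Set.Ioc a b) := by
  have hlog : 0 < Real.log 2 := Real.log_pos one_lt_two
  have hq : -1 < -(s / Real.log 2) := neg_lt_neg ((div_lt_one hlog).2 hs2)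
  refine Integrable.mono' (integrableOn_rpow_div hab hq)
    (Real.measurable_exp.comp (measurable_staircase s a b)).aestronglyMeasurable ?_
  rw [ae_restrict_iff' measurableSet_Ioc]
  refine ae_of_all _ fun x hx => ?_
  have hpos : 0 < (x - a) / (b - a) := div_pos (by linarith [hx.1]) (by linarith)
  rw [Real.norm_of_nonneg (Real.exp_pos _).le, Real.rpow_def_of_pos hpos, Real.exp_le_exp]
  have hfl := Int.floor_le (-Real.logb 2 ((x - a) / (b - a)))
  have : staircase s a b x ≤ s * -Real.logb 2 ((x - a) / (b - a)) :=
    mul_le_mul_of_nonneg_left (by linarith) hs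
  refine this.trans (le_of_eq ?_)
  rw [Real.logb]
  ring

lemma integrableOn_staircase_sq {s a b : ℝ} (hab : a < b) :
    IntegrableOn (fun x => staircase s a b x ^ 2) (Set.Ioc a b) := by
  -- the square is dominated by the exponential of the staircase with step `1 / 2 < log 2`
  have hlog2 := Real.log_two_gt_d9
  have hint := (integrableOn_exp_staircase (s := 1 / 2) (by norm_num) (by linarith) hab).const_mul
    (s ^ 2 * 16)
  refine Integrable.mono' hint
    ((measurable_staircase s a b).pow_const 2).aestronglyMeasurable ?_
  rw [ae_restrict_iff' measurableSet_Ioc]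
  refine ae_of_all _ fun x hx => ?_
  have hpos : 0 < (x - a) / (b - a) := div_pos (by linarith [hx.1]) (by linarith)
  have h1 : (x - a) / (b - a) ≤ 1 := by rw [div_le_one (by linarith)]; linarith [hx.2]
  have hN : (0 : ℤ) ≤ ⌊-Real.logb 2 ((x - a) / (b - a))⌋ := by
    rw [Int.floor_nonneg]
    have := Real.logb_nonpos one_lt_two hpos.le h1
    linarith
  have hN' : (0 : ℝ) ≤ ⌊-Real.logb 2 ((x - a) / (b - a))⌋ := by exact_mod_cast hN
  rw [Real.norm_of_nonneg (sq_nonneg _), staircase, staircase, mul_pow, mul_assoc]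
  refine mul_le_mul_of_nonneg_left ?_ (sq_nonneg s)
  set N : ℝ := (⌊-Real.logb 2 ((x - a) / (b - a))⌋ : ℝ)
  have hq := Real.quadratic_le_exp_of_nonneg (show 0 ≤ N / 2 by linarith)
  have he : Real.exp (1 / 2 * (N - 1)) = Real.exp (N / 2) * Real.exp (-(1 / 2)) := by
    rw [← Real.exp_add]; ring_nf
  have hh : 1 / 2 ≤ Real.exp (-(1 / 2) : ℝ) := by
    have := Real.add_one_le_exp (-(1 / 2) : ℝ)
    linarith
  rw [he]
  have : Real.exp (N / 2) * (1 / 2) ≤ Real.exp (N / 2) * Real.exp (-(1 / 2)) :=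
    mul_le_mul_of_nonneg_left hh (Real.exp_pos _).le
  nlinarith

lemma integrableOn_staircase {s a b : ℝ} (hab : a < b) :
    IntegrableOn (staircase s a b) (Set.Ioc a b) := by
  have h1 : IntegrableOn (fun _ : ℝ => (1 : ℝ)) (Set.Ioc a b) := integrableOn_const (by simp)
  refine Integrable.mono' (h1.add (integrableOn_staircase_sq (s := s) hab))
    (measurable_staircase s a b).aestronglyMeasurable (ae_of_all _ fun x => ?_)
  rw [Real.norm_eq_abs, Pi.add_apply]
  refine abs_le.2 ⟨?_, ?_⟩ <;> nlinarith [sq_nonneg (staircase s a b x - 1),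
    sq_nonneg (staircase s a b x + 1)]

/-- The distribution of the staircase does not depend on the interval. -/
lemma setAverage_comp_staircase (f : ℝ → ℝ) {s a b : ℝ} (hab : a < b) :
    ⨍ x in Set.Ioc a b, f (staircase s a b x) =
      ⨍ x in Set.Ioc 0 1, f (staircase s 0 1 x) := by
  have hb : b - a ≠ 0 := by linarith
  have h := intervalIntegral.integral_comp_add_mul (a := 0) (b := 1)
    (fun x => f (staircase s a b x)) hb a
  have e : ∀ y : ℝ, staircase s a b (a + (b - a) * y) = staircase s 0 1 y := by
    intro y
    simp only [staircase, add_sub_cancel_left, sub_zero, div_one]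
    rw [mul_div_cancel_left₀ _ hb]
  simp only [e, mul_zero, add_zero, mul_one, add_sub_cancel] at h
  rw [intervalIntegral.integral_of_le zero_le_one, intervalIntegral.integral_of_le hab.le,
    smul_eq_mul] at h
  rw [setAverage_Ioc hab, setAverage_Ioc zero_lt_one, ← h]
  simp

/-- Self-similarity of the staircase, for averages of functions of it. -/
lemma setAverage_comp_staircase_split (f : ℝ → ℝ) {s a b : ℝ} (hab : a < b)
    (hf : IntegrableOn (fun x => f (staircase s a b x)) (Set.Ioc a b)) :
    ⨍ x in Set.Ioc a b, f (staircase s a b x) =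
      ((⨍ x in Set.Ioc a b, f (staircase s a b x + s)) + f (-s)) / 2 := by
  have h1 : a < (a + b) / 2 := by linarith
  have h2 : (a + b) / 2 < b := by linarith
  rw [setAverage_Ioc_split hab hf]
  congr 2
  · rw [setAverage_comp_staircase (fun y => f (y + s)) hab,
      ← setAverage_comp_staircase (fun y => f (y + s)) h1]
    exact setAverage_congr_fun measurableSet_Ioc
      (ae_of_all _ fun x hx => by simp only [staircase_left_half hx])
  · rw [setAverage_congr_fun measurableSet_Ioc (g := fun _ => f (-s))
      (ae_of_all _ fun x hx => by simp only [staircase_right_half hx])]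
    exact setAverage_const (by simp [h2]) (by simp) _

lemma setAverage_Ioc_const {a b : ℝ} (hab : a < b) (k : ℝ) : ⨍ _ in Set.Ioc a b, k = k :=
  setAverage_const (by simp [hab]) (by simp) _

lemma setAverage_Ioc_add {a b : ℝ} (hab : a < b) {f g : ℝ → ℝ} (hf : IntegrableOn f (Set.Ioc a b))
    (hg : IntegrableOn g (Set.Ioc a b)) :
    ⨍ x in Set.Ioc a b, (f x + g x) =
      (⨍ x in Set.Ioc a b, f x) + ⨍ x in Set.Ioc a b, g x := by
  rw [setAverage_Ioc hab, setAverage_Ioc hab, setAverage_Ioc hab, integral_add hf hg, mul_add]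

lemma setAverage_Ioc_const_mul {a b : ℝ} (hab : a < b) (k : ℝ) (f : ℝ → ℝ) :
    ⨍ x in Set.Ioc a b, k * f x = k * ⨍ x in Set.Ioc a b, f x := by
  rw [setAverage_Ioc hab, setAverage_Ioc hab, integral_const_mul, mul_left_comm]

lemma setAverage_staircase {s a b : ℝ} (hab : a < b) :
    ⨍ x in Set.Ioc a b, staircase s a b x = 0 := by
  have h := setAverage_comp_staircase_split (fun y => y) hab (integrableOn_staircase (s := s) hab)
  have hc : IntegrableOn (fun _ : ℝ => s) (Set.Ioc a b) := integrableOn_const (by simp)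
  rw [setAverage_Ioc_add hab (integrableOn_staircase hab) hc, setAverage_Ioc_const hab] at h
  linarith

lemma setAverage_staircase_sq {s a b : ℝ} (hab : a < b) :
    ⨍ x in Set.Ioc a b, staircase s a b x ^ 2 = 2 * s ^ 2 := by
  have h := setAverage_comp_staircase_split (fun y => y ^ 2) hab
    (integrableOn_staircase_sq (s := s) hab)
  have hc : IntegrableOn (fun _ : ℝ => s ^ 2) (Set.Ioc a b) := integrableOn_const (by simp)
  have hl : IntegrableOn (fun x => 2 * s * staircase s a b x) (Set.Ioc a b) :=
    (integrableOn_staircase hab).const_mul _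
  have hlc : IntegrableOn (fun x => 2 * s * staircase s a b x + s ^ 2) (Set.Ioc a b) := hl.add hc
  have e : ∀ x, (staircase s a b x + s) ^ 2 =
      staircase s a b x ^ 2 + (2 * s * staircase s a b x + s ^ 2) := fun x => by ring
  simp only [e] at h
  rw [setAverage_Ioc_add hab (integrableOn_staircase_sq hab) hlc,
    setAverage_Ioc_add hab hl hc, setAverage_Ioc_const hab, setAverage_Ioc_const_mul hab,
    setAverage_staircase hab] at h
  linarith

lemma setAverage_exp_staircase {s a b : ℝ} (hs : 0 ≤ s) (hs2 : s < Real.log 2) (hab : a < b) :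
    ⨍ x in Set.Ioc a b, Real.exp (staircase s a b x) = Real.exp (-s) / (2 - Real.exp s) := by
  have hexp : Real.exp s < 2 := by rwa [← Real.lt_log_iff_exp_lt (by norm_num)]
  have h := setAverage_comp_staircase_split Real.exp hab (integrableOn_exp_staircase hs hs2 hab)
  have e : ∀ x, Real.exp (staircase s a b x + s) = Real.exp s * Real.exp (staircase s a b x) :=
    fun x => by rw [Real.exp_add, mul_comm]
  simp only [e] at h
  rw [setAverage_Ioc_const_mul hab] at h
  rw [eq_div_iff (by linarith)]
  linarith

/-! ### The oscillation of the staircase -/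

lemma dyadicInterval_subset {a b : ℝ} (hab : a < b) (n : ℕ) (m : Fin (2 ^ n)) :
    dyadicInterval a b n m ⊆ Set.Ioc a b := by
  have hm : ((m : ℕ) : ℝ) + 1 ≤ 2 ^ n := by exact_mod_cast m.2
  have hb : 0 < b - a := by linarith
  refine Set.Ioc_subset_Ioc ?_ ?_
  · have : 0 ≤ (b - a) * ((m : ℕ) : ℝ) / 2 ^ n := by positivity
    linarith
  · have : (b - a) * (((m : ℕ) : ℝ) + 1) / 2 ^ n ≤ b - a := by
      rw [div_le_iff₀ (by positivity)]
      exact mul_le_mul_of_nonneg_left hm hb.le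
    linarith

lemma dyadicInterval_endpoints_lt {a b : ℝ} (hab : a < b) (n : ℕ) (m : Fin (2 ^ n)) :
    a + (b - a) * ((m : ℕ) : ℝ) / 2 ^ n < a + (b - a) * (((m : ℕ) : ℝ) + 1) / 2 ^ n := by
  have hb : 0 < b - a := by linarith
  have h : (b - a) * ((m : ℕ) : ℝ) < (b - a) * (((m : ℕ) : ℝ) + 1) :=
    mul_lt_mul_of_pos_left (lt_add_one _) hb
  linarith [div_lt_div_of_pos_right h (show (0 : ℝ) < 2 ^ n by positivity)]

/-- The mean square oscillation does not change when a constant is added. -/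
lemma meanSqOsc_congr_add_const {φ χ : ℝ → ℝ} {k c d : ℝ} (hcd : c < d)
    (hχ : IntegrableOn χ (Set.Ioc c d)) (h : ∀ x ∈ Set.Ioc c d, φ x = χ x + k) :
    meanSqOsc φ (Set.Ioc c d) = meanSqOsc χ (Set.Ioc c d) := by
  have hc : IntegrableOn (fun _ : ℝ => k) (Set.Ioc c d) := integrableOn_const (by simp)
  have hmean : ⨍ y in Set.Ioc c d, φ y = (⨍ y in Set.Ioc c d, χ y) + k := by
    rw [setAverage_congr_fun measurableSet_Ioc (ae_of_all _ h), setAverage_Ioc_add hcd hχ hc,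
      setAverage_Ioc_const hcd]
  rw [meanSqOsc, meanSqOsc, setLAverage_eq, setLAverage_eq, hmean]
  congr 1
  refine setLIntegral_congr_fun measurableSet_Ioc fun x hx => ?_
  simp only [h x hx, add_sub_add_right_eq_sub]

lemma meanSqOsc_staircase {s a b : ℝ} (hab : a < b) :
    meanSqOsc (staircase s a b) (Set.Ioc a b) = ENNReal.ofReal (2 * s ^ 2) := by
  have h := setAverage_staircase_sq (s := s) hab
  have hi := integrableOn_staircase_sq (s := s) hab
  rw [meanSqOsc_eq_ofReal_intervalVar hab, intervalVar] <;>
    simp only [setAverage_staircase hab, sub_zero]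
  · rw [h]
  · exact hi

/-- The induction passes to the left half, where the staircase is a shifted smaller one; on the
right half it is constant. -/
lemma dyadicOscLE_staircase {s a b : ℝ} (hab : a < b) :
    DyadicOscLE (2 * s ^ 2) (staircase s a b) a b := by
  refine ⟨integrableOn_staircase hab, fun n => ?_⟩
  induction n generalizing a b with
  | zero => intro m; rw [dyadicInterval_gen_zero, meanSqOsc_staircase hab]
  | succ n ih =>
    intro m
    have h1 : a < (a + b) / 2 := by linarith
    have h2 : (a + b) / 2 < b := by linarith
    rcases lt_or_ge (m : ℕ) (2 ^ n) with hm | hm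
    · have e : dyadicInterval a b (n + 1) m = dyadicInterval a ((a + b) / 2) n ⟨m, hm⟩ :=
        (dyadicInterval_left_half a b n ⟨m, hm⟩).symm
      have hsub := dyadicInterval_subset h1 n ⟨m, hm⟩
      have hshift : meanSqOsc (staircase s a b) (dyadicInterval a ((a + b) / 2) n ⟨m, hm⟩) =
          meanSqOsc (staircase s a ((a + b) / 2)) (dyadicInterval a ((a + b) / 2) n ⟨m, hm⟩) :=
        meanSqOsc_congr_add_const (dyadicInterval_endpoints_lt h1 n ⟨m, hm⟩)
          ((integrableOn_staircase h1).mono_set hsub) fun x hx => staircase_left_half (hsub hx)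
      rw [e, hshift]
      exact ih h1 _
    · have hm' : (m : ℕ) - 2 ^ n < 2 ^ n := by
        have h := m.2
        have h' := pow_succ 2 n
        omega
      have e : dyadicInterval a b (n + 1) m =
          dyadicInterval ((a + b) / 2) b n ⟨(m : ℕ) - 2 ^ n, hm'⟩ := by
        rw [dyadicInterval_right_half]
        congr 1
        ext
        exact (Nat.sub_add_cancel hm).symm
      have hsub := dyadicInterval_subset h2 n ⟨(m : ℕ) - 2 ^ n, hm'⟩
      have hconst : meanSqOsc (staircase s a b)
          (dyadicInterval ((a + b) / 2) b n ⟨(m : ℕ) - 2 ^ n, hm'⟩) =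
          meanSqOsc (fun _ => 0) (dyadicInterval ((a + b) / 2) b n ⟨(m : ℕ) - 2 ^ n, hm'⟩) :=
        meanSqOsc_congr_add_const (k := -s) (dyadicInterval_endpoints_lt h2 n _)
          integrableOn_zero fun x hx => by rw [staircase_right_half (hsub hx), zero_add]
      rw [e, hconst]
      simp [meanSqOsc]

/-! ### The sharp inequality and the threshold -/

theorem mainTheorem2 (a b : ℝ) (hab : a < b) :
    -- the inequality below the threshold
    (∀ ε : ℝ, 0 ≤ ε → ε < √2 * Real.log 2 →
      ∀ φ ∈ dyadicBMOBall a b ε,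
        IntegrableOn (fun x => Real.exp (φ x)) (Set.Ioc a b) ∧
        ⨍ x in Set.Ioc a b, Real.exp (φ x) ≤
          Real.exp (-(ε / √2)) / (2 - Real.exp (ε / √2)) *
            Real.exp (⨍ x in Set.Ioc a b, φ x)) ∧
    -- the constant cannot be lowered
    (∀ ε : ℝ, 0 ≤ ε → ε < √2 * Real.log 2 →
      ∀ C : ℝ,
        (∀ φ ∈ dyadicBMOBall a b ε,
          ⨍ x in Set.Ioc a b, Real.exp (φ x) ≤ C * Real.exp (⨍ x in Set.Ioc a b, φ x)) →
        Real.exp (-(ε / √2)) / (2 - Real.exp (ε / √2)) ≤ C) ∧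
    -- at and above the threshold no finite constant works
    (∀ ε : ℝ, √2 * Real.log 2 ≤ ε →
      ∀ C : ℝ, ∃ φ ∈ dyadicBMOBall a b ε,
        IntegrableOn (fun x => Real.exp (φ x)) (Set.Ioc a b) ∧
        C * Real.exp (⨍ x in Set.Ioc a b, φ x) < ⨍ x in Set.Ioc a b, Real.exp (φ x)) := by
  have h2 : 0 < √2 := Real.sqrt_pos.2 two_pos
  have h22 : √2 ^ 2 = (2 : ℝ) := Real.sq_sqrt two_pos.le
  have hsq : ∀ ε : ℝ, 2 * (ε / √2) ^ 2 = ε ^ 2 := fun ε => by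
    rw [div_pow, h22]; ring
  have hlt : ∀ ε : ℝ, ε < √2 * Real.log 2 → ε / √2 < Real.log 2 := fun ε hε => by
    rwa [div_lt_iff₀' h2]
  refine ⟨fun ε hε hε2 φ hφ => ?_, fun ε hε hε2 C hC => ?_, fun ε hε C => ?_⟩
  · rw [mem_dyadicBMOBall_iff hε, ← hsq] at hφ
    exact exp_integral_le (div_nonneg hε h2.le) (hlt ε hε2) hab hφ
  · have h := hC (staircase (ε / √2) a b) (by
      rw [mem_dyadicBMOBall_iff hε, ← hsq]
      exact dyadicOscLE_staircase hab)
    rwa [setAverage_staircase hab, Real.exp_zero, mul_one,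
      setAverage_exp_staircase (div_nonneg hε h2.le) (hlt ε hε2) hab] at h
  · -- With `s = log (2 - η)` the ratio is `1 / ((2 - η) η) ≥ 1 / (2 η) = |C| + 1`.
    set η : ℝ := 1 / (2 * (|C| + 1)) with hη
    have hC := abs_nonneg C
    have hη0 : 0 < η := by positivity
    have hη1 : η ≤ 1 := by
      rw [hη, div_le_one (by positivity)]
      linarith
    have hCη : (|C| + 1) * (2 * η) = 1 := by
      rw [hη]
      field_simp
    have hs0 : 0 ≤ Real.log (2 - η) := Real.log_nonneg (by linarith)
    have hs2 : Real.log (2 - η) < Real.log 2 := Real.log_lt_log (by linarith) (by linarith)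
    have hε0 : 0 ≤ ε := (mul_nonneg h2.le (hs0.trans hs2.le)).trans hε
    refine ⟨staircase (Real.log (2 - η)) a b, ?_, integrableOn_exp_staircase hs0 hs2 hab, ?_⟩
    · rw [mem_dyadicBMOBall_iff hε0]
      have h := dyadicOscLE_staircase (s := Real.log (2 - η)) hab
      refine ⟨h.1, fun n m => (h.2 n m).trans (ENNReal.ofReal_le_ofReal ?_)⟩
      have h3 : √2 * Real.log (2 - η) ≤ ε := (mul_le_mul_of_nonneg_left hs2.le h2.le).trans hε
      calc 2 * Real.log (2 - η) ^ 2 = (√2 * Real.log (2 - η)) ^ 2 := by rw [mul_pow, h22]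
        _ ≤ ε ^ 2 := pow_le_pow_left₀ (mul_nonneg h2.le hs0) h3 2
    · rw [setAverage_staircase hab, setAverage_exp_staircase hs0 hs2 hab, Real.exp_zero, mul_one,
        Real.exp_neg, Real.exp_log (by linarith), sub_sub_cancel, lt_div_iff₀ hη0]
      have h3 : C * η ≤ |C| * η := mul_le_mul_of_nonneg_right (le_abs_self C) hη0.le
      have h4 : (2 : ℝ)⁻¹ ≤ (2 - η)⁻¹ := inv_anti₀ (by linarith) (by linarith)
      linarith
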